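/- Let $n>2$ be an integer. For $0<s<n$ put $\gamma_s=2^{-s}\pi^{-n/2}\,\Gamma\!\left(\tfrac{n-s}{2}\right)/\Gamma\!\left(\tfrac{s}{2}\right)$, let $v_n$ be the volume of the unit ball of $\mathbb{R}^n$, and let $$I_s(f)(x)=\gamma_s\int_{\mathbb{R}^n}\frac{f(x-y)}{|y|^{n-s}}\,dy$$ be the Riesz potential of a (real- or complex-valued) function $f\in L^1(\mathbb{R}^n)$; the integral converges absolutely for almost every $x$. Let $$\mathcal{C}_{n,s}=\sup_{0\neq f\in L^1(\mathbb{R}^n)}\frac{\|I_s(f)\|_{L^{n/(n-s),\infty}(\mathbb{R}^n)}}{\|f\|_{L^1(\mathbb{R}^n)}},\qquad \|g\|_{L^{n/(n-s),\infty}(\mathbb{R}^n)}=\sup_{\lambda>0}\lambda\,\bigl|\{x\in\mathbb{R}^n:|g(x)|>\lambda\}\bigr|^{\frac{n-s}{n}},$$ be the best constant of the $(L^1,L^{n/(n-s),\infty})$ inequality for $I_s$. Then for every $0<s<\frac{n-2}{4}$ the constant $\mathcal{C}_{n,s}$ is finite and $$\gamma_s v_n^{\frac{n-s}{n}}\,\frac{n-2-4s}{2s(n-2-s)}\;\le\;\mathcal{C}_{n,s}\;\le\;\gamma_s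 v_n^{\frac{n-s}{n}}\,\frac{n}{s}.$$ Moreover, for fixed $n$, as $s\to0^+$ one has $\mathcal{C}_{n,s}=O(\gamma_s/s)$ and $\gamma_s/s=O(1)$, hence $\mathcal{C}_{n,s}=O(1)$. -/

import Mathlib

open MeasureTheory Filter Asymptotics
open scoped ENNReal Topology

noncomputable section

namespace RieszWeak

/-- Euclidean space `ℝⁿ`, with the Euclidean norm and Lebesgue measure. -/
abbrev Rn (n : ℕ) : Type := EuclideanSpace ℝ (Fin n)

/-- The normalising constant `γ_s = 2^{-s} π^{-n/2} Γ((n-s)/2) / Γ(s/2)`. -/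
def rieszGamma (n : ℕ) (s : ℝ) : ℝ :=
  (2 : ℝ) ^ (-s) * Real.pi ^ (-((n : ℝ) / 2)) *
    (Real.Gamma (((n : ℝ) - s) / 2) / Real.Gamma (s / 2))

/-- The volume `v_n` of the unit ball of `ℝⁿ`. -/
def unitBallVolume (n : ℕ) : ℝ :=
  (volume (Metric.ball (0 : Rn n) 1)).toReal

/-- The Riesz potential `I_s f (x) = γ_s ∫ f (x - y) / |y|^{n-s} dy` of a real or complex function.
For integrable `f` and `0 < s < n` the integral converges absolutely for almost every `x`. -/
def rieszPotential {𝕜 : Type*} [RCLike 𝕜] (n : ℕ) (s : ℝ) (f : Rn n → 𝕜) (x : Rn n) : 𝕜 :=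
  (rieszGamma n s : 𝕜) * ∫ y : Rn n, f (x - y) / ((‖y‖ ^ ((n : ℝ) - s) : ℝ) : 𝕜)

/-- The weak `L^q` quasinorm `‖g‖_{L^{q,∞}} = sup_{t > 0} t |{x : |g x| > t}|^{1/q}`,
with values in `[0, ∞]`. -/
def weakNorm {𝕜 : Type*} [RCLike 𝕜] {n : ℕ} (q : ℝ) (g : Rn n → 𝕜) : ℝ≥0∞ :=
  ⨆ (t : ℝ) (_ : 0 < t), ENNReal.ofReal t * volume {x : Rn n | t < ‖g x‖} ^ (1 / q)

/-- The best constant of the `(L¹, L^{n/(n-s),∞})` inequality for `I_s`: the supremum in `[0, ∞]`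
of `‖I_s f‖_{L^{n/(n-s),∞}} / ‖f‖_{L¹}` over all `f ∈ L¹(ℝⁿ)` that are not almost everywhere zero
(functions with values in `𝕜`, which is `ℝ` or `ℂ`). -/
def bestConst (𝕜 : Type*) [RCLike 𝕜] (n : ℕ) (s : ℝ) : ℝ≥0∞ :=
  ⨆ (f : Rn n → 𝕜) (_ : MemLp f 1 volume) (_ : eLpNorm f 1 volume ≠ 0),
    weakNorm ((n : ℝ) / ((n : ℝ) - s)) (rieszPotential n s f) / eLpNorm f 1 volume

end RieszWeak

end

namespace RieszWeak

/-! Upper bound: let `A` have finite measure and lie where `γ_s (|f| * |y|^{s-n}) ≥ t`. Then `t|A|`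
is at most the integral of that potential over `A`. By Tonelli this reduces to `∫_A |x-z|^{s-n} dx`,
which the bathtub principle bounds by the integral over a ball of volume `|A|` about `z`, namely
`(n/s) v_n^{(n-s)/n} |A|^{s/n}`. Cancelling `|A|^{s/n}` gives the weak-type estimate.

Lower bound: testing on the indicator of the unit ball yields the factor `1/(2s)`, which dominates
the stated one because `(n-2-4s)/(n-2-s) ≤ 1`. For `s ≤ 1/2` the potential is bounded below near the
origin; for `s ≥ 1/2` its behaviour at infinity suffices.

Asymptotics: `Γ(s/2) = Γ(s/2+1)/(s/2)`, so `γ_s/s` converges as `s → 0⁺`. -/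

/-- **Bathtub principle**: among sets of at most a given finite measure, the integral of `K` is
largest on a superlevel set of `K`. -/
theorem setLIntegral_le_of_superlevel {α : Type*} [MeasurableSpace α] {μ : Measure α}
    {K : α → ℝ≥0∞} {A B : Set α} (hA : MeasurableSet A) (hB : MeasurableSet B)
    (hAB : μ A ≤ μ B) (hfin : μ A ≠ ∞) {c : ℝ≥0∞}
    (hout : ∀ x ∉ B, K x ≤ c) (hin : ∀ x ∈ B, c ≤ K x) :
    ∫⁻ x in A, K x ∂μ ≤ ∫⁻ x in B, K x ∂μ := by
  -- Finiteness of `μ A` allows `μ (A ∩ B)` to be cancelled.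
  have hdiff : μ (A \ B) ≤ μ (B \ A) := by
    have h1 := measure_inter_add_sdiff (μ := μ) A hB
    have h2 := measure_inter_add_sdiff (μ := μ) B hA
    rw [Set.inter_comm B A] at h2
    rw [← h1, ← h2] at hAB
    exact (ENNReal.add_le_add_iff_left
      (measure_ne_top_of_subset Set.inter_subset_left hfin)).1 hAB
  rw [← lintegral_inter_add_sdiff K A hB, ← lintegral_inter_add_sdiff K B hA, Set.inter_comm B A]
  refine add_le_add_right ?_ _
  calc ∫⁻ x in A \ B, K x ∂μ ≤ ∫⁻ _ in A \ B, c ∂μ :=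
        setLIntegral_mono' (hA.diff hB) fun x hx => hout x hx.2
    _ = c * μ (A \ B) := setLIntegral_const _ _
    _ ≤ c * μ (B \ A) := by gcongr
    _ = ∫⁻ _ in B \ A, c ∂μ := (setLIntegral_const _ _).symm
    _ ≤ ∫⁻ x in B \ A, K x ∂μ := setLIntegral_mono' (hB.diff hA) fun x hx => hin x hx.1

/-! ### Constants and the Riesz kernel on balls -/

variable {n : ℕ} {s : ℝ}

theorem unitBallVolume_pos (n : ℕ) : 0 < unitBallVolume n :=
  ENNReal.toReal_pos (Metric.measure_ball_pos volume _ one_pos).ne' measure_ball_lt_top.ne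

theorem ofReal_unitBallVolume (n : ℕ) :
    ENNReal.ofReal (unitBallVolume n) = volume (Metric.ball (0 : Rn n) 1) :=
  ENNReal.ofReal_toReal measure_ball_lt_top.ne

theorem rieszGamma_pos (hs : 0 < s) (hsn : s < n) : 0 < rieszGamma n s := by
  have h1 : 0 < Real.Gamma (((n : ℝ) - s) / 2) := Real.Gamma_pos_of_pos (by linarith)
  have h2 : 0 < Real.Gamma (s / 2) := Real.Gamma_pos_of_pos (by linarith)
  have := Real.pi_pos
  unfold rieszGamma
  positivity

theorem volume_ball_eq (x : Rn n) {r : ℝ} (hr : 0 < r) :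
    volume (Metric.ball x r) = ENNReal.ofReal (unitBallVolume n * r ^ n) := by
  rw [Measure.addHaar_ball_of_pos _ _ hr, ENNReal.ofReal_mul (unitBallVolume_pos n).le,
    ofReal_unitBallVolume, finrank_euclideanSpace_fin, mul_comm]

theorem pow_pred_mul_inv_rpow (hn : 0 < n) {y : ℝ} (hy : 0 < y) :
    y ^ (n - 1) * (y ^ ((n : ℝ) - s))⁻¹ = y ^ (s - 1) := by
  rw [← Real.rpow_natCast, ← Real.rpow_neg hy.le, ← Real.rpow_add hy, Nat.cast_sub hn]
  congr 1
  push_cast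
  ring

theorem integrableOn_ball_rieszKernel (hn : 0 < n) (hs : 0 < s) (r : ℝ) :
    IntegrableOn (fun y : Rn n => (‖y‖ ^ ((n : ℝ) - s))⁻¹) (Metric.ball 0 r) := by
  have : Nonempty (Fin n) := ⟨⟨0, hn⟩⟩
  rw [integrableOn_fun_norm_addHaar volume (f := fun t : ℝ => (t ^ ((n : ℝ) - s))⁻¹),
    finrank_euclideanSpace_fin]
  have h := (intervalIntegral.intervalIntegrable_rpow' (a := 0) (b := r)
    (r := s - 1) (by linarith)).1
  refine (h.mono_set Set.Ioo_subset_Ioc_self).congr_fun (fun y hy => ?_) measurableSet_Ioo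
  simp only [smul_eq_mul]
  rw [pow_pred_mul_inv_rpow hn hy.1]

theorem setIntegral_ball_rieszKernel (hn : 0 < n) (hs : 0 < s) {r : ℝ} (hr : 0 < r) :
    ∫ y in Metric.ball (0 : Rn n) r, (‖y‖ ^ ((n : ℝ) - s))⁻¹
      = n / s * unitBallVolume n * r ^ s := by
  have : Nonempty (Fin n) := ⟨⟨0, hn⟩⟩
  have h1 := integral_fun_norm_addHaar (volume : Measure (Rn n))
    (Set.indicator (Set.Iio r) fun t : ℝ => (t ^ ((n : ℝ) - s))⁻¹)
  have h2 : ∀ x : Rn n, Set.indicator (Set.Iio r) (fun t : ℝ => (t ^ ((n : ℝ) - s))⁻¹) ‖x‖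
      = Set.indicator (Metric.ball 0 r) (fun y : Rn n => (‖y‖ ^ ((n : ℝ) - s))⁻¹) x := by
    intro x
    simp [Set.indicator]
  simp_rw [h2] at h1
  rw [integral_indicator measurableSet_ball] at h1
  rw [h1, finrank_euclideanSpace_fin]
  have h3 : ∫ y in Set.Ioi (0 : ℝ), y ^ (n - 1) •
      Set.indicator (Set.Iio r) (fun t : ℝ => (t ^ ((n : ℝ) - s))⁻¹) y = r ^ s / s := by
    have h4 : ∀ y ∈ Set.Ioi (0 : ℝ), y ^ (n - 1) •
      Set.indicator (Set.Iio r) (fun t : ℝ => (t ^ ((n : ℝ) - s))⁻¹) y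
        = Set.indicator (Set.Iio r) (fun t => t ^ (s - 1)) y := by
      intro y hy
      by_cases hyr : y < r
      · simp [hyr, pow_pred_mul_inv_rpow hn (Set.mem_Ioi.1 hy)]
      · simp [hyr]
    rw [setIntegral_congr_fun measurableSet_Ioi h4, setIntegral_indicator measurableSet_Iio,
      Set.Ioi_inter_Iio, ← integral_Ioc_eq_integral_Ioo,
      ← intervalIntegral.integral_of_le hr.le, integral_rpow (Or.inl (by linarith))]
    simp [Real.zero_rpow hs.ne']
  rw [h3, nsmul_eq_mul, smul_eq_mul, Measure.real, ← unitBallVolume]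
  ring

/-! ### Rearrangement bound for the extended kernel -/

/-- The Riesz kernel `|y|^{s-n}` with values in `[0, ∞]`, equal to `∞` at the origin. -/
noncomputable def eKernel (n : ℕ) (s : ℝ) (y : Rn n) : ℝ≥0∞ := ‖y‖ₑ ^ (s - n)

theorem ennreal_rpow_le_rpow_of_nonpos {a b : ℝ≥0∞} {p : ℝ} (hp : p ≤ 0) (hab : a ≤ b) : b ^ p ≤ a ^ p := by
  rw [← neg_neg p, ENNReal.rpow_neg, ENNReal.rpow_neg a]
  exact ENNReal.inv_le_inv.2 (ENNReal.rpow_le_rpow hab (neg_nonneg.2 hp))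

theorem measurable_eKernel : Measurable (eKernel n s) := by
  unfold eKernel
  fun_prop

theorem eKernel_eq_ofReal {y : Rn n} (hy : y ≠ 0) :
    eKernel n s y = ENNReal.ofReal ((‖y‖ ^ ((n : ℝ) - s))⁻¹) := by
  rw [eKernel, ← ofReal_norm, ENNReal.ofReal_rpow_of_pos (norm_pos_iff.2 hy),
    ← Real.rpow_neg (norm_nonneg y), neg_sub]

/-- Only an inequality at the origin: the real kernel is `0⁻¹ = 0` there, whereas the extended one
is `∞`, which keeps it decreasing in `‖y‖`. -/
theorem ofReal_inv_le_eKernel (hsn : s < n) (y : Rn n) :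
    ENNReal.ofReal ((‖y‖ ^ ((n : ℝ) - s))⁻¹) ≤ eKernel n s y := by
  rcases eq_or_ne y 0 with rfl | hy
  · simp [Real.zero_rpow (sub_pos.2 hsn).ne']
  · rw [eKernel_eq_ofReal hy]

theorem setLIntegral_ball_eKernel (hn : 0 < n) (hs : 0 < s) {r : ℝ} (hr : 0 < r) :
    ∫⁻ y in Metric.ball (0 : Rn n) r, eKernel n s y
      = ENNReal.ofReal (n / s * unitBallVolume n * r ^ s) := by
  have : Nonempty (Fin n) := ⟨⟨0, hn⟩⟩
  rw [← setIntegral_ball_rieszKernel hn hs hr, ofReal_integral_eq_lintegral_ofReal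
    (integrableOn_ball_rieszKernel hn hs r) (Eventually.of_forall fun y => by positivity)]
  refine lintegral_congr_ae (ae_restrict_of_ae ?_)
  filter_upwards [compl_mem_ae_iff.2 (measure_singleton (0 : Rn n))] with y hy
  exact eKernel_eq_ofReal hy

theorem setLIntegral_eKernel_le (hn : 0 < n) (hs : 0 < s) (hsn : s < n) {A : Set (Rn n)}
    (hA : MeasurableSet A) (hfin : volume A ≠ ∞) :
    ∫⁻ y in A, eKernel n s y ≤ ENNReal.ofReal (n / s * unitBallVolume n ^ (((n : ℝ) - s) / n)) *
      volume A ^ (s / n) := by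
  have hn' : (0 : ℝ) < n := Nat.cast_pos.2 hn
  have hv := unitBallVolume_pos n
  rcases eq_or_ne (volume A) 0 with h0 | h0
  · rw [setLIntegral_measure_zero _ _ h0]
    exact zero_le
  set a := (volume A).toReal with ha
  have hapos : 0 < a := ENNReal.toReal_pos h0 hfin
  have haA : volume A = ENNReal.ofReal a := (ENNReal.ofReal_toReal hfin).symm
  -- The radius for which the centred ball has volume `a`; it is a superlevel set of the kernel at
  -- height `r^{s-n}`.
  set r : ℝ := (a / unitBallVolume n) ^ (1 / (n : ℝ)) with hr
  have hrpos : 0 < r := by positivity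
  have hrn : unitBallVolume n * r ^ n = a := by
    rw [hr, ← Real.rpow_natCast, ← Real.rpow_mul (by positivity), one_div,
      inv_mul_cancel₀ hn'.ne', Real.rpow_one]
    field_simp
  have hB := volume_ball_eq (0 : Rn n) hrpos
  rw [hrn, ← haA] at hB
  refine (setLIntegral_le_of_superlevel (K := eKernel n s) hA
    (measurableSet_ball (x := (0 : Rn n)) (ε := r)) hB.ge hfin
    (c := ENNReal.ofReal r ^ (s - n)) (fun x hx => ?_) (fun x hx => ?_)).trans_eq ?_
  · rw [mem_ball_zero_iff, not_lt] at hx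
    rw [eKernel, ← ofReal_norm]
    exact ennreal_rpow_le_rpow_of_nonpos (by linarith) (ENNReal.ofReal_le_ofReal hx)
  · rw [mem_ball_zero_iff] at hx
    rw [eKernel, ← ofReal_norm]
    exact ennreal_rpow_le_rpow_of_nonpos (by linarith) (ENNReal.ofReal_le_ofReal hx.le)
  · rw [setLIntegral_ball_eKernel hn hs hrpos, haA, ENNReal.ofReal_rpow_of_pos hapos,
      ← ENNReal.ofReal_mul (by positivity)]
    congr 1
    rw [hr, ← Real.rpow_mul (by positivity), Real.div_rpow hapos.le hv.le, sub_div,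
      div_self hn'.ne', Real.rpow_sub hv, Real.rpow_one, one_div_mul_eq_div]
    ring

theorem setLIntegral_eKernel_sub_le (hn : 0 < n) (hs : 0 < s) (hsn : s < n) {A : Set (Rn n)}
    (hA : MeasurableSet A) (hfin : volume A ≠ ∞) (z : Rn n) :
    ∫⁻ x in A, eKernel n s (x - z) ≤
      ENNReal.ofReal (n / s * unitBallVolume n ^ (((n : ℝ) - s) / n)) * volume A ^ (s / n) := by
  have hmp : MeasurePreserving (fun x : Rn n => x + z) volume volume :=
    measurePreserving_add_right volume z
  have hvol := hmp.measure_preimage hA.nullMeasurableSet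
  have h := hmp.setLIntegral_comp_preimage hA (f := fun x => eKernel n s (x - z))
    (measurable_eKernel.comp (measurable_id.sub_const z))
  simp only [add_sub_cancel_right] at h
  rw [← h, ← hvol]
  exact setLIntegral_eKernel_le hn hs hsn (hmp.measurable hA) (by rwa [hvol])

/-! ### Weak-type upper bound -/

/-- The potential `∫ |f(x - y)| |y|^{s-n} dy` with values in `[0, ∞]`. -/
noncomputable def ePotential (n : ℕ) (s : ℝ) (F : Rn n → ℝ≥0∞) (x : Rn n) : ℝ≥0∞ :=
  ∫⁻ z, F z * eKernel n s (x - z)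

theorem measurable_ePotential {F : Rn n → ℝ≥0∞} (hF : Measurable F) :
    Measurable (ePotential n s F) := by
  unfold ePotential
  refine Measurable.lintegral_prod_right' (f := fun p : Rn n × Rn n =>
    F p.2 * eKernel n s (p.1 - p.2)) ?_
  exact (hF.comp measurable_snd).mul (measurable_eKernel.comp (measurable_fst.sub measurable_snd))

theorem setLIntegral_ePotential_le (hn : 0 < n) (hs : 0 < s) (hsn : s < n) {F : Rn n → ℝ≥0∞}
    (hF : Measurable F) {A : Set (Rn n)} (hA : MeasurableSet A) (hfin : volume A ≠ ∞) :
    ∫⁻ x in A, ePotential n s F x ≤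
      ENNReal.ofReal (n / s * unitBallVolume n ^ (((n : ℝ) - s) / n)) * volume A ^ (s / n) *
        ∫⁻ z, F z := by
  unfold ePotential
  rw [lintegral_lintegral_swap, mul_comm, ← lintegral_mul_const _ hF]
  · gcongr with z
    have hm : Measurable fun x : Rn n => eKernel n s (x - z) :=
      measurable_eKernel.comp (measurable_id.sub_const z)
    rw [lintegral_const_mul _ hm]
    gcongr
    exact setLIntegral_eKernel_sub_le hn hs hsn hA hfin z
  · exact ((hF.comp measurable_snd).mul
      (measurable_eKernel.comp (measurable_fst.sub measurable_snd))).aemeasurable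

variable {𝕜 : Type*} [RCLike 𝕜]

theorem enorm_rieszPotential_le (hs : 0 < s) (hsn : s < n) {f : Rn n → 𝕜} {F : Rn n → ℝ≥0∞}
    (hF : ∀ᵐ x, ‖f x‖ₑ = F x) (x : Rn n) :
    ‖rieszPotential n s f x‖ₑ ≤ ENNReal.ofReal (rieszGamma n s) * ePotential n s F x := by
  have hγ := rieszGamma_pos hs hsn
  rw [rieszPotential, enorm_mul]
  gcongr
  · rw [← ofReal_norm, RCLike.norm_ofReal, abs_of_pos hγ]
  · refine (enorm_integral_le_lintegral_enorm _).trans ?_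
    have h := lintegral_sub_left_eq_self (μ := (volume : Measure (Rn n)))
      (fun z => F z * eKernel n s (x - z)) x
    simp only [sub_sub_cancel] at h
    rw [ePotential, ← h]
    refine lintegral_mono_ae ?_
    have hq : Measure.QuasiMeasurePreserving (fun y : Rn n => x - y) volume volume :=
      quasiMeasurePreserving_sub_left_of_right_invariant volume x
    filter_upwards [hq.ae hF] with y hy
    rw [div_eq_mul_inv, enorm_mul, hy]
    gcongr
    refine le_trans (le_of_eq ?_) (ofReal_inv_le_eKernel hsn y)
    rw [← ofReal_norm, norm_inv, RCLike.norm_ofReal, abs_of_nonneg (by positivity)]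

/-- **Weak-type estimate** for the Riesz potential with the constant `γ_s v_n^{(n-s)/n} n / s`. -/
theorem weakNorm_rieszPotential_le (hn : 0 < n) (hs : 0 < s) (hsn : s < n) {f : Rn n → 𝕜}
    (hf : MemLp f 1 volume) :
    weakNorm ((n : ℝ) / ((n : ℝ) - s)) (rieszPotential n s f) ≤
      ENNReal.ofReal (rieszGamma n s * unitBallVolume n ^ (((n : ℝ) - s) / n) * ((n : ℝ) / s)) *
        eLpNorm f 1 volume := by
  have hn' : (0 : ℝ) < n := Nat.cast_pos.2 hn
  have hv := unitBallVolume_pos n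
  have hγ := rieszGamma_pos hs hsn
  set p : ℝ := ((n : ℝ) - s) / n with hp
  have hppos : 0 < p := div_pos (by linarith) hn'
  have hexp : 1 / ((n : ℝ) / ((n : ℝ) - s)) = p := one_div_div _ _
  -- `f` is only a.e. strongly measurable; Tonelli is applied to a measurable representative.
  set g := hf.1.mk f with hg
  set F : Rn n → ℝ≥0∞ := fun x => ‖g x‖ₑ with hFdef
  have hFm : Measurable F := hf.1.stronglyMeasurable_mk.enorm
  have hF : ∀ᵐ x, ‖f x‖ₑ = F x := by
    filter_upwards [hf.1.ae_eq_mk] with x hx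
    rw [hFdef, hg, hx]
  have hnorm : ∫⁻ z, F z = eLpNorm f 1 volume := by
    rw [eLpNorm_one_eq_lintegral_enorm]
    exact (lintegral_congr_ae hF).symm
  rw [weakNorm, hexp]
  refine iSup₂_le fun t ht => ?_
  set E : Set (Rn n) :=
    {x | ENNReal.ofReal t ≤ ENNReal.ofReal (rieszGamma n s) * ePotential n s F x} with hE
  have hEm : MeasurableSet E :=
    measurableSet_le measurable_const ((measurable_ePotential hFm).const_mul _)
  have hsub : {x : Rn n | t < ‖rieszPotential n s f x‖} ⊆ E := by
    intro x hx
    refine le_trans ?_ (enorm_rieszPotential_le hs hsn hF x)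
    rw [← ofReal_norm]
    exact ENNReal.ofReal_le_ofReal (le_of_lt hx)
  set C := ENNReal.ofReal (rieszGamma n s * unitBallVolume n ^ p * ((n : ℝ) / s)) *
    eLpNorm f 1 volume with hC
  have hfinite : ∀ A ⊆ E, MeasurableSet A → volume A ≠ ∞ →
      ENNReal.ofReal t * volume A ^ p ≤ C := by
    intro A hAE hA hfin
    rcases eq_or_ne (volume A) 0 with h0 | h0
    · simp [h0, ENNReal.zero_rpow_of_pos hppos]
    have h1 : ENNReal.ofReal t * volume A ≤ C * volume A ^ (s / n) := by
      calc ENNReal.ofReal t * volume A = ∫⁻ _ in A, ENNReal.ofReal t := (setLIntegral_const _ _).symm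
        _ ≤ ∫⁻ x in A, ENNReal.ofReal (rieszGamma n s) * ePotential n s F x :=
            setLIntegral_mono' hA fun x hx => hAE hx
        _ = ENNReal.ofReal (rieszGamma n s) * ∫⁻ x in A, ePotential n s F x :=
            lintegral_const_mul _ (measurable_ePotential hFm)
        _ ≤ ENNReal.ofReal (rieszGamma n s) * (ENNReal.ofReal (n / s * unitBallVolume n ^ p) *
              volume A ^ (s / n) * ∫⁻ z, F z) := by
            gcongr
            exact setLIntegral_ePotential_le hn hs hsn hFm hA hfin
        _ = C * volume A ^ (s / n) := by
            rw [hC, hnorm, mul_assoc (rieszGamma n s), ENNReal.ofReal_mul hγ.le,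
              mul_comm (unitBallVolume n ^ p)]
            ring
    have h2 : volume A = volume A ^ p * volume A ^ (s / n) := by
      rw [← ENNReal.rpow_add _ _ h0 hfin, hp, ← add_div, sub_add_cancel, div_self hn'.ne',
        ENNReal.rpow_one]
    nth_rewrite 1 [h2] at h1
    rw [← mul_assoc] at h1
    have hpos : 0 < s / n := by positivity
    exact (ENNReal.mul_le_mul_iff_left (by simp [h0, hfin, hpos.not_gt])
      (by simp [hfin, h0, hpos.not_gt])).1 h1
  refine (mul_le_mul_right (ENNReal.rpow_le_rpow (measure_mono hsub) hppos.le) _).trans ?_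
  have ht0 : ENNReal.ofReal t ≠ 0 := by simpa using ht
  -- `E` might have infinite measure, where cancellation fails, so it is exhausted from inside by
  -- sets of finite measure.
  have hEle : volume E ≤ (C / ENNReal.ofReal t) ^ p⁻¹ := by
    refine le_of_forall_lt fun r hr => ?_
    obtain ⟨A, hA, hAE, hrA, hAtop⟩ := Measure.exists_subset_measure_lt_top hEm hr
    refine hrA.trans_le ?_
    rw [ENNReal.le_rpow_inv_iff hppos, ENNReal.le_div_iff_mul_le (Or.inl ht0)
      (Or.inl ENNReal.ofReal_ne_top), mul_comm]
    exact hfinite A hAE hA hAtop.ne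
  rw [ENNReal.le_rpow_inv_iff hppos, ENNReal.le_div_iff_mul_le (Or.inl ht0)
    (Or.inl ENNReal.ofReal_ne_top), mul_comm] at hEle
  exact hEle

theorem bestConst_le (𝕜 : Type*) [RCLike 𝕜] (hn : 0 < n) (hs : 0 < s) (hsn : s < n) :
    bestConst 𝕜 n s ≤
      ENNReal.ofReal
        (rieszGamma n s * unitBallVolume n ^ (((n : ℝ) - s) / n) * ((n : ℝ) / s)) :=
  iSup_le fun _ => iSup₂_le fun hf _ =>
    ENNReal.div_le_of_le_mul (weakNorm_rieszPotential_le hn hs hsn hf)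

/-! ### Lower bound from the unit ball -/

theorem ofReal_mul_volume_rpow_le_weakNorm {q : ℝ} {g : Rn n → 𝕜} {a : ℝ}
    {S : Set (Rn n)} (hq : 0 ≤ q) (h : ∀ x ∈ S, a ≤ ‖g x‖) :
    ENNReal.ofReal a * volume S ^ (1 / q) ≤ weakNorm q g := by
  rcases le_or_gt a 0 with ha | ha
  · simp [ENNReal.ofReal_of_nonpos ha]
  -- The weak norm uses strict superlevel sets, so the level `a` is approached from below.
  refine ENNReal.mul_le_of_forall_lt fun b hb c hc => ?_
  have hbtop : b ≠ ∞ := (hb.trans ENNReal.ofReal_lt_top).ne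
  rcases eq_or_ne b 0 with rfl | hb0
  · simp
  refine le_trans ?_ (le_iSup₂ (f := fun (t : ℝ) (_ : 0 < t) =>
    ENNReal.ofReal t * volume {x : Rn n | t < ‖g x‖} ^ (1 / q)) b.toReal
    (ENNReal.toReal_pos hb0 hbtop))
  have hba : b.toReal < a := by
    rwa [← ENNReal.lt_ofReal_iff_toReal_lt hbtop]
  rw [ENNReal.ofReal_toReal hbtop]
  gcongr
  refine hc.le.trans ?_
  gcongr
  exact fun x hx => hba.trans_le (h x hx)

theorem rieszPotential_indicator_ball (n : ℕ) (s : ℝ) (x : Rn n) :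
    rieszPotential n s ((Metric.ball (0 : Rn n) 1).indicator fun _ => (1 : 𝕜)) x =
      ((rieszGamma n s * ∫ y in Metric.ball x 1, (‖y‖ ^ ((n : ℝ) - s))⁻¹ : ℝ) : 𝕜) := by
  rw [rieszPotential, RCLike.ofReal_mul, ← integral_indicator measurableSet_ball,
    ← integral_ofReal]
  congr 2
  ext y
  by_cases hy : y ∈ Metric.ball x 1
  · have hy' : x - y ∈ Metric.ball (0 : Rn n) 1 := by
      rwa [mem_ball_zero_iff, ← dist_eq_norm, dist_comm]
    simp [Set.indicator_of_mem hy, Set.indicator_of_mem hy']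
  · have hy' : x - y ∉ Metric.ball (0 : Rn n) 1 := by
      rwa [mem_ball_zero_iff, ← dist_eq_norm, dist_comm]
    simp [Set.indicator_of_notMem hy, Set.indicator_of_notMem hy']

theorem eLpNorm_indicator_ball (n : ℕ) :
    eLpNorm ((Metric.ball (0 : Rn n) 1).indicator fun _ => (1 : 𝕜)) 1 volume =
      ENNReal.ofReal (unitBallVolume n) := by
  rw [eLpNorm_indicator_const measurableSet_ball one_ne_zero ENNReal.one_ne_top,
    ofReal_unitBallVolume]
  simp

theorem integrableOn_unit_ball_rieszKernel (hn : 0 < n) (hs : 0 < s) (x : Rn n) :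
    IntegrableOn (fun y : Rn n => (‖y‖ ^ ((n : ℝ) - s))⁻¹) (Metric.ball x 1) :=
  (integrableOn_ball_rieszKernel hn hs (1 + ‖x‖)).mono_set
    (Metric.ball_subset_ball' (by simp))

/-- Testing the best constant on the indicator of the unit ball. -/
theorem le_bestConst_of_le_setIntegral (𝕜 : Type*) [RCLike 𝕜] (hn : 0 < n) (hs : 0 < s)
    (hsn : s < n) {a r : ℝ} (ha : 0 ≤ a) (hr : 0 < r)
    (h : ∀ x ∈ Metric.ball (0 : Rn n) r,
      a * unitBallVolume n ≤ ∫ y in Metric.ball x 1, (‖y‖ ^ ((n : ℝ) - s))⁻¹) :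
    ENNReal.ofReal (rieszGamma n s * unitBallVolume n ^ (((n : ℝ) - s) / n) *
      (a * r ^ ((n : ℝ) - s))) ≤ bestConst 𝕜 n s := by
  have hn' : (0 : ℝ) < n := Nat.cast_pos.2 hn
  have hv := unitBallVolume_pos n
  have hγ := rieszGamma_pos hs hsn
  set f : Rn n → 𝕜 := (Metric.ball (0 : Rn n) 1).indicator fun _ => (1 : 𝕜) with hf
  have hnorm : eLpNorm f 1 volume = ENNReal.ofReal (unitBallVolume n) := eLpNorm_indicator_ball n
  have hmem : MemLp f 1 volume :=
    memLp_indicator_const 1 measurableSet_ball 1 (Or.inr measure_ball_lt_top.ne)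
  have hne : eLpNorm f 1 volume ≠ 0 := by
    rw [hnorm]
    simpa using hv
  refine le_trans ?_ (le_iSup_of_le f (le_iSup₂_of_le hmem hne le_rfl))
  rw [ENNReal.le_div_iff_mul_le (Or.inl hne) (Or.inl hmem.2.ne), hnorm,
    ← ENNReal.ofReal_mul (by positivity)]
  refine le_trans (le_of_eq ?_) (ofReal_mul_volume_rpow_le_weakNorm
    (a := rieszGamma n s * (a * unitBallVolume n)) (S := Metric.ball 0 r)
    (div_nonneg hn'.le (by linarith)) fun x hx => ?_)
  · rw [volume_ball_eq _ hr, ENNReal.ofReal_rpow_of_pos (by positivity), one_div_div,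
      ← ENNReal.ofReal_mul (by positivity), Real.mul_rpow hv.le (by positivity),
      ← Real.rpow_natCast, ← Real.rpow_mul hr.le, mul_div_cancel₀ _ hn'.ne']
    congr 1
    ring
  · rw [hf, rieszPotential_indicator_ball, RCLike.norm_ofReal]
    exact (mul_le_mul_of_nonneg_left (h x hx) hγ.le).trans (le_abs_self _)

/-- For `|x| < r` the ball `B(x,1)` contains `B(0,1-r)`, where the kernel integral is explicit. -/
theorem le_bestConst_of_lt_one (𝕜 : Type*) [RCLike 𝕜] (hn : 0 < n) (hs : 0 < s)
    (hsn : s < n) {r : ℝ} (hr : 0 < r) (hr1 : r < 1) :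
    ENNReal.ofReal (rieszGamma n s * unitBallVolume n ^ (((n : ℝ) - s) / n) *
      (n / s * (1 - r) ^ s * r ^ ((n : ℝ) - s))) ≤ bestConst 𝕜 n s := by
  have hr2 : 0 < 1 - r := by linarith
  refine le_bestConst_of_le_setIntegral 𝕜 hn hs hsn (by positivity) hr fun x hx => ?_
  rw [mem_ball_zero_iff] at hx
  calc n / s * (1 - r) ^ s * unitBallVolume n
      = ∫ y in Metric.ball (0 : Rn n) (1 - r), (‖y‖ ^ ((n : ℝ) - s))⁻¹ := by
        rw [setIntegral_ball_rieszKernel hn hs hr2]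
        ring
    _ ≤ _ := setIntegral_mono_set (integrableOn_unit_ball_rieszKernel hn hs x)
        (Eventually.of_forall fun y => by positivity)
        (Metric.ball_subset_ball' (by rw [dist_zero_left]; linarith)).eventuallyLE

/-- For `|x| < r` the kernel is at least `(r+1)^{s-n}` a.e. on `B(x,1)`; the factor tends to `1` as
`r → ∞`. -/
theorem le_bestConst_of_pos (𝕜 : Type*) [RCLike 𝕜] (hn : 0 < n) (hs : 0 < s)
    (hsn : s < n) {r : ℝ} (hr : 0 < r) :
    ENNReal.ofReal (rieszGamma n s * unitBallVolume n ^ (((n : ℝ) - s) / n) *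
      ((r / (r + 1)) ^ ((n : ℝ) - s))) ≤ bestConst 𝕜 n s := by
  have : Nonempty (Fin n) := ⟨⟨0, hn⟩⟩
  have h : (r / (r + 1)) ^ ((n : ℝ) - s) = ((r + 1) ^ ((n : ℝ) - s))⁻¹ * r ^ ((n : ℝ) - s) := by
    rw [Real.div_rpow hr.le (by positivity)]
    ring
  rw [h]
  refine le_bestConst_of_le_setIntegral 𝕜 hn hs hsn (by positivity) hr fun x hx => ?_
  rw [mem_ball_zero_iff] at hx
  calc ((r + 1) ^ ((n : ℝ) - s))⁻¹ * unitBallVolume n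
      = ∫ _ in Metric.ball x 1, ((r + 1) ^ ((n : ℝ) - s))⁻¹ := by
        rw [setIntegral_const, Measure.real, volume_ball_eq x one_pos,
          ENNReal.toReal_ofReal (by simpa using (unitBallVolume_pos n).le), smul_eq_mul]
        simp [mul_comm]
    _ ≤ _ := by
        refine integral_mono_ae (integrableOn_const measure_ball_lt_top.ne)
          (integrableOn_unit_ball_rieszKernel hn hs x) ?_
        filter_upwards [ae_restrict_of_ae (compl_mem_ae_iff.2 (measure_singleton (0 : Rn n))),
          ae_restrict_mem measurableSet_ball] with y hy hyx
        have hypos : 0 < ‖y‖ := norm_pos_iff.2 hy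
        rw [Metric.mem_ball, dist_eq_norm] at hyx
        have hyr : ‖y‖ ≤ r + 1 := by
          have := norm_le_norm_add_norm_sub x y
          rw [norm_sub_rev] at this
          linarith
        exact inv_anti₀ (by positivity) (Real.rpow_le_rpow hypos.le hyr (by linarith))

theorem le_bestConst (𝕜 : Type*) [RCLike 𝕜] (hn : 0 < n) (hs : 0 < s) (hsn : s < n) :
    ENNReal.ofReal (rieszGamma n s * unitBallVolume n ^ (((n : ℝ) - s) / n)) ≤
      bestConst 𝕜 n s := by
  have h1 : Tendsto (fun r : ℝ => r / (r + 1)) atTop (𝓝 1) := by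
    have h := (tendsto_inv_atTop_zero.comp (tendsto_atTop_add_const_right atTop (1 : ℝ)
      tendsto_id)).const_sub 1
    rw [sub_zero] at h
    refine h.congr' ?_
    filter_upwards [eventually_gt_atTop 0] with r hr
    simp only [Function.comp_apply, id_eq]
    field_simp
    ring
  have h2 := (h1.rpow_const (p := (n : ℝ) - s) (Or.inl one_ne_zero)).const_mul
    (rieszGamma n s * unitBallVolume n ^ (((n : ℝ) - s) / n))
  rw [Real.one_rpow, mul_one] at h2
  refine le_of_tendsto (ENNReal.tendsto_ofReal h2) ?_
  filter_upwards [eventually_gt_atTop 0] with r hr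
  exact le_bestConst_of_pos 𝕜 hn hs hsn hr

/-- With `r = 1 - 1/(2n)`, Bernoulli gives `r^n ≥ 1/2`, while `n (2n)^{-s} ≥ √(n/2) ≥ 1` for `s ≤
1/2`. -/
theorem half_le_mul_rpow (hn : 2 ≤ n) (hs : 0 < s) (hs2 : s ≤ 1 / 2) :
    1 / 2 ≤ (n : ℝ) * (1 - (1 - 1 / (2 * (n : ℝ)))) ^ s *
      (1 - 1 / (2 * (n : ℝ))) ^ ((n : ℝ) - s) := by
  have hn' : (2 : ℝ) ≤ n := by exact_mod_cast hn
  have hinv : 1 / (2 * (n : ℝ)) ≤ 1 / 4 := one_div_le_one_div_of_le (by norm_num) (by linarith)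
  have hinv0 : 0 < 1 / (2 * (n : ℝ)) := by positivity
  have h1 : 1 ≤ (n : ℝ) * (1 / (2 * (n : ℝ))) ^ s := by
    have h2 : 1 / (n : ℝ) ≤ (1 / (2 * (n : ℝ))) ^ (1 / 2 : ℝ) := by
      rw [← Real.sqrt_eq_rpow]
      refine Real.le_sqrt_of_sq_le ?_
      rw [div_pow, one_pow]
      exact one_div_le_one_div_of_le (by linarith) (by nlinarith)
    have h3 : (1 / (2 * (n : ℝ))) ^ (1 / 2 : ℝ) ≤ (1 / (2 * (n : ℝ))) ^ s :=
      Real.rpow_le_rpow_of_exponent_ge hinv0 (by linarith) hs2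
    rw [div_le_iff₀' (by linarith)] at h2
    exact h2.trans (mul_le_mul_of_nonneg_left h3 (by linarith))
  have h4 : 1 / 2 ≤ (1 - 1 / (2 * (n : ℝ))) ^ ((n : ℝ) - s) := by
    calc (1 : ℝ) / 2 = 1 + n * (-(1 / (2 * (n : ℝ)))) := by field_simp; norm_num
      _ ≤ (1 + -(1 / (2 * (n : ℝ)))) ^ n := one_add_mul_le_pow (by linarith) n
      _ = (1 - 1 / (2 * (n : ℝ))) ^ (n : ℝ) := by rw [Real.rpow_natCast, sub_eq_add_neg]
      _ ≤ _ := Real.rpow_le_rpow_of_exponent_ge (by linarith) (by linarith) (by linarith)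
  rw [sub_sub_cancel]
  nlinarith

theorem le_bestConst_one_div (𝕜 : Type*) [RCLike 𝕜] (hn : 2 ≤ n) (hs : 0 < s) (hsn : s < n) :
    ENNReal.ofReal (rieszGamma n s * unitBallVolume n ^ (((n : ℝ) - s) / n) * (1 / (2 * s))) ≤
      bestConst 𝕜 n s := by
  have hn' : (2 : ℝ) ≤ n := by exact_mod_cast hn
  have hv := unitBallVolume_pos n
  have hγ := rieszGamma_pos hs hsn
  rcases le_total s (1 / 2) with hs2 | hs2
  · have hinv : 1 / (2 * (n : ℝ)) ≤ 1 / 4 := one_div_le_one_div_of_le (by norm_num) (by linarith)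
    have hinv0 : 0 < 1 / (2 * (n : ℝ)) := by positivity
    refine le_trans ?_ (le_bestConst_of_lt_one 𝕜 (by lia) hs hsn
      (r := 1 - 1 / (2 * (n : ℝ))) (by linarith) (by linarith))
    refine ENNReal.ofReal_le_ofReal (mul_le_mul_of_nonneg_left ?_ (by positivity))
    have h := div_le_div_of_nonneg_right (half_le_mul_rpow hn hs hs2) hs.le
    refine le_trans (le_of_eq ?_) (h.trans_eq ?_)
    · field_simp
    · ring
  · refine le_trans (ENNReal.ofReal_le_ofReal ?_) (le_bestConst 𝕜 (by lia) hs hsn)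
    refine mul_le_of_le_one_right (by positivity) ?_
    rw [div_le_one (by linarith)]
    linarith

/-! ### Behaviour as `s → 0⁺` -/

theorem tendsto_rieszGamma_div (hn : 0 < n) :
    Tendsto (fun s : ℝ => rieszGamma n s / s) (𝓝[>] 0)
      (𝓝 (Real.pi ^ (-((n : ℝ) / 2)) * Real.Gamma ((n : ℝ) / 2) / 2)) := by
  have hn' : (0 : ℝ) < n := Nat.cast_pos.2 hn
  have hG : ∀ t : ℝ, 0 < t → ContinuousAt Real.Gamma t := fun t ht =>
    (Real.differentiableAt_Gamma fun m h => by
      have : (0 : ℝ) ≤ m := m.cast_nonneg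
      linarith).continuousAt
  -- This is `γ_s/s` with the pole of `Γ(s/2)` at `0` absorbed by the functional equation.
  have hc : ContinuousAt (fun s : ℝ => (2 : ℝ) ^ (-s) * Real.pi ^ (-((n : ℝ) / 2)) *
      (Real.Gamma (((n : ℝ) - s) / 2) / (2 * Real.Gamma (s / 2 + 1)))) 0 := by
    have h1 : ContinuousAt (fun s : ℝ => Real.Gamma (((n : ℝ) - s) / 2)) 0 :=
      ContinuousAt.comp' (f := fun s : ℝ => ((n : ℝ) - s) / 2)
        (hG _ (by simpa using hn')) (by fun_prop)
    have h2 : ContinuousAt (fun s : ℝ => Real.Gamma (s / 2 + 1)) 0 :=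
      ContinuousAt.comp' (f := fun s : ℝ => s / 2 + 1) (hG _ (by simp)) (by fun_prop)
    have h3 : ContinuousAt (fun s : ℝ => (2 : ℝ) ^ (-s)) 0 :=
      (Real.continuous_const_rpow two_ne_zero).continuousAt.comp' continuousAt_neg
    exact (h3.mul continuousAt_const).mul (h1.div (continuousAt_const.mul h2) (by simp))
  have ht := hc.tendsto.mono_left (nhdsWithin_le_nhds (s := Set.Ioi (0 : ℝ)))
  refine (ht.congr' ?_).trans (le_of_eq ?_)
  · filter_upwards [self_mem_nhdsWithin] with s hs
    have hs' : (0 : ℝ) < s := hs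
    have := (Real.Gamma_pos_of_pos (half_pos hs')).ne'
    rw [Real.Gamma_add_one (half_pos hs').ne', rieszGamma]
    field_simp
  · congr 1
    simp
    ring

theorem isBigO_bestConst (𝕜 : Type*) [RCLike 𝕜] (hn : 0 < n) :
    (fun s : ℝ => (bestConst 𝕜 n s).toReal) =O[𝓝[>] 0] fun s : ℝ => rieszGamma n s / s := by
  have hn' : (0 : ℝ) < n := Nat.cast_pos.2 hn
  have hv := unitBallVolume_pos n
  refine IsBigO.of_bound (max 1 (unitBallVolume n) * n) ?_
  filter_upwards [Ioo_mem_nhdsGT hn'] with s hs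
  have hγ := rieszGamma_pos hs.1 hs.2
  have hpow : unitBallVolume n ^ (((n : ℝ) - s) / n) ≤ max 1 (unitBallVolume n) := by
    have h0 : 0 ≤ ((n : ℝ) - s) / n := div_nonneg (by linarith [hs.2]) hn'.le
    have h1 : ((n : ℝ) - s) / n ≤ 1 := by
      rw [div_le_one hn']
      linarith [hs.1]
    calc _ ≤ max 1 (unitBallVolume n) ^ (((n : ℝ) - s) / n) :=
          Real.rpow_le_rpow hv.le (le_max_right _ _) h0
      _ ≤ max 1 (unitBallVolume n) ^ (1 : ℝ) :=
          Real.rpow_le_rpow_of_exponent_le (le_max_left _ _) h1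
      _ = _ := Real.rpow_one _
  have hs0 := hs.1
  rw [Real.norm_of_nonneg ENNReal.toReal_nonneg, Real.norm_of_nonneg (by positivity)]
  calc _ ≤ rieszGamma n s * unitBallVolume n ^ (((n : ℝ) - s) / n) * ((n : ℝ) / s) :=
        ENNReal.toReal_le_of_le_ofReal (by positivity) (bestConst_le 𝕜 hn hs.1 hs.2)
    _ ≤ rieszGamma n s * max 1 (unitBallVolume n) * ((n : ℝ) / s) := by gcongr
    _ = _ := by ring

end RieszWeak

theorem theorem1p3 (𝕜 : Type*) [RCLike 𝕜] (n : ℕ) (hn : 2 < n) :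
    (∀ s : ℝ, 0 < s → s < ((n : ℝ) - 2) / 4 →
      RieszWeak.bestConst 𝕜 n s ≠ ∞ ∧
      RieszWeak.rieszGamma n s * RieszWeak.unitBallVolume n ^ (((n : ℝ) - s) / n) *
          (((n : ℝ) - 2 - 4 * s) / (2 * s * ((n : ℝ) - 2 - s)))
        ≤ (RieszWeak.bestConst 𝕜 n s).toReal ∧
      (RieszWeak.bestConst 𝕜 n s).toReal
        ≤ RieszWeak.rieszGamma n s * RieszWeak.unitBallVolume n ^ (((n : ℝ) - s) / n) *
          ((n : ℝ) / s)) ∧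
    (fun s : ℝ => (RieszWeak.bestConst 𝕜 n s).toReal)
      =O[𝓝[>] 0] (fun s : ℝ => RieszWeak.rieszGamma n s / s) ∧
    (fun s : ℝ => RieszWeak.rieszGamma n s / s) =O[𝓝[>] 0] (fun _ : ℝ => (1 : ℝ)) ∧
    (fun s : ℝ => (RieszWeak.bestConst 𝕜 n s).toReal) =O[𝓝[>] 0] (fun _ : ℝ => (1 : ℝ)) := by
  have hn0 : 0 < n := by lia
  have hbig := RieszWeak.isBigO_bestConst 𝕜 hn0
  have hγ := (RieszWeak.tendsto_rieszGamma_div hn0).isBigO_one ℝ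
  refine ⟨fun s hs hs4 => ?_, hbig, hγ, hbig.trans hγ⟩
  have hn' : (2 : ℝ) < n := by exact_mod_cast hn
  have hsn : s < n := by linarith
  have hγs := RieszWeak.rieszGamma_pos hs hsn
  have hv := RieszWeak.unitBallVolume_pos n
  have hle := RieszWeak.bestConst_le 𝕜 hn0 hs hsn
  have hfin : RieszWeak.bestConst 𝕜 n s ≠ ∞ := (hle.trans_lt ENNReal.ofReal_lt_top).ne
  refine ⟨hfin, ?_, ENNReal.toReal_le_of_le_ofReal (by positivity) hle⟩
  refine le_trans ?_ ((ENNReal.ofReal_le_iff_le_toReal hfin).1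
    (RieszWeak.le_bestConst_one_div 𝕜 hn.le hs hsn))
  refine mul_le_mul_of_nonneg_left ?_ (by positivity)
  -- What remains is `(n-2-4s)/(2s(n-2-s)) ≤ 1/(2s)`.
  rw [div_le_div_iff₀ (mul_pos (by linarith) (by linarith)) (by linarith)]
  nlinarith
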